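/- Let $\mathbb K$ be a field and let $\mathcal C\subseteq\mathbb K^n$ be an $[n,k]$ MDS code, i.e. a linear code of dimension $k\ge 1$ whose minimum distance is $n-k+1$. Let $G$ be a generating $k\times n$ matrix of $\mathcal C$ (its rows form a basis of $\mathcal C$). For any matrix $H$ over $\mathbb K$ with rows indexed by a finite set $S$ and columns indexed by a set of $N$ elements, let $R_H=\mathbb K[x_s: s\in S]$, let $\ell^H_j=\sum_{s\in S}H_{sj}x_s\in R_H$ be the linear form dual to the $j$-th column, and let $I_a(H)\subseteq R_H$ be the ideal generated by the $a\times a$ minors of the diagonal matrix with diagonal entries $\ell^H_j$ (so $I_0(H)=R_H$ and $I_a(H)=0$ for $a>N$). Let $$\mathrm{Fitt}(H)=\bigoplus_{a=0}^{N} I_a(H)/I_{a+1}(H)$$ be the Fitting module of $\bigoplus_j R_H/\langle\ell^H_j\rangle$, graded by $\mathrm{Fitt}(H)_d=\bigoplus_a \bigl(I_a(H)/I_{a+1}(H)\bigr)_d$. Write $R=R_G=\mathbb K[x_1,\dots,x_k]$ and $\mathrm{Fitt}(\mathcal C)=\mathrm{Fitt}(G)$. Fix a column $i$ of $G$, with dual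 form $\ell=\ell^G_i$, and $p\in\{1,\dots,k\}$. The deletion (puncturing) $\mathcal C'$ at $\ell$ is given by the matrix $G'$ obtained from $G$ by removing column $i$, and $\mathrm{Fitt}(\mathcal C')=\mathrm{Fitt}(G')$ is a graded $R$-module. There is an invertible $k\times k$ matrix $A$ such that the $i$-th column of $AG$ is the standard basis vector $e_p$. For any such $A$, the restriction (shortening) $\mathcal C''$ at $\ell$ is given by the matrix $G''$ obtained from $AG$ by removing row $p$ and column $i$; the $\mathbb K$-algebra map $\pi:R\to R'':=R_{G''}=\mathbb K[x_q: q\ne p]$, $x_j\mapsto\sum_{q\neq p}A_{qj}x_q$, is surjective with kernel $\langle\ell\rangle$, and it makes $\mathrm{Fitt}(\mathcal C'')=\mathrm{Fitt}(G'')$ a graded $R$-module. Then there is a short exact sequence of graded $R$-modules $$0\longrightarrow \mathrm{Fitt}(\mathcal C')(-1)\xrightarrow{\ \cdot\ell\ }\mathrm{Fitt}(\mathcal C)\longrightarrow\mathrm{Fitt}(\mathcal C'')\longrightarrow 0,$$ with maps homogeneous of degree $0$, where $M(-1)_d=M_{d-1}$. The first map sends the class of $x\in I_a(G')$ in $I_a(G')/I_{a+1}(G')$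 to the class of $\ell x$ in $I_{a+1}(G)/I_{a+2}(G)$, and the second sends the class of $x\in I_a(G)$ in $I_a(G)/I_{a+1}(G)$ to the class of $\pi(x)$ in $I_a(G'')/I_{a+1}(G'')$. -/

import Mathlib

open scoped DirectSum

/-! ## Linear codes -/

open Classical in
/-- The minimum distance of a linear code: the smallest weight (number of nonzero entries) of a
nonzero codeword. -/
noncomputable def minDistance {K : Type*} [Field K] {n : ℕ} (C : Submodule K (Fin n → K)) : ℕ :=
  sInf {w : ℕ | ∃ c ∈ C, c ≠ 0 ∧ w = hammingNorm c}

/-- `G` is a generating `k × n` matrix of the code `C`: the rows of `G` form a basis of `C`. In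
particular `C` has dimension `k`. -/
def IsGeneratingMatrix {K : Type*} [Field K] {n k : ℕ}
    (C : Submodule K (Fin n → K)) (G : Matrix (Fin k) (Fin n) K) : Prop :=
  LinearIndependent K G.row ∧ Submodule.span K (Set.range G.row) = C

/-- A linear code `C` of length `n` and dimension `k` is MDS if its minimum distance is
`n - k + 1`. (The zero code, which has no minimum distance, is not MDS here.) -/
def IsMDS {K : Type*} [Field K] {n : ℕ} (C : Submodule K (Fin n → K)) : Prop :=
  minDistance C + Module.finrank K C = n + 1

/-- The generating matrix of the deletion (puncturing) at the `i`-th column: remove that column. -/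
def deletion {K : Type*} {σ ι : Type*} (G : Matrix σ ι K) (i : ι) :
    Matrix σ {j : ι // j ≠ i} K :=
  G.submatrix id Subtype.val

/-- For a generating matrix `G` whose `i`-th column is the basis vector `e_p`: the generating matrix
of the restriction (shortening) at that column, obtained by removing row `p` and column `i`. -/
def restriction {K : Type*} {σ ι : Type*} (G : Matrix σ ι K) (p : σ) (i : ι) :
    Matrix {q : σ // q ≠ p} {j : ι // j ≠ i} K :=
  G.submatrix Subtype.val Subtype.val

/-! ## Linear forms -/

/-- The linear form `∑ v_s x_s` dual to the vector `v`. -/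
noncomputable def linearForm {K : Type*} [Field K] {σ : Type*} [Fintype σ] (v : σ → K) :
    MvPolynomial σ K :=
  ∑ s, MvPolynomial.C (v s) * MvPolynomial.X s

/-- The collection of linear forms dual to the columns of `G`. -/
noncomputable def columnForms {K : Type*} [Field K] {σ ι : Type*} [Fintype σ]
    (G : Matrix σ ι K) (j : ι) : MvPolynomial σ K :=
  linearForm (fun s => G s j)

/-- Restriction of polynomial functions to the hyperplane cut out by one linear form: apply the
linear change of coordinates `A`, then set the coordinate `x_p` to zero. It sends the form dual to a
vector `v` to the form dual to `A v` with the entry `p` removed. For `A = 1` this is the quotient map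
`K[x_s : s] → K[x_s : s] / (x_p) = K[x_s : s ≠ p]`. -/
noncomputable def restrictionHom {K : Type*} [Field K] {σ : Type*} [Fintype σ] [DecidableEq σ]
    (A : Matrix σ σ K) (p : σ) : MvPolynomial σ K →ₐ[K] MvPolynomial {q : σ // q ≠ p} K :=
  MvPolynomial.aeval fun j => linearForm fun q : {q : σ // q ≠ p} => A q.1 j

/-! ## Fitting modules -/

/-- The ideal `I_j(φ)` generated by the `j × j` minors of `φ`. (Choices of rows or columns with
repetitions or in another order only contribute `0` or `±` a minor.) It is the unit ideal for `j = 0`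
and zero for `j` larger than the number of rows or of columns. -/
def minorIdeal {R : Type*} [CommRing R] {m n : Type*} (φ : Matrix m n R) (j : ℕ) : Ideal R :=
  Ideal.span {a | ∃ (r : Fin j → m) (c : Fin j → n), a = (φ.submatrix r c).det}

/-- The `R`-module `I_j(φ) / I_{j+1}(φ)`. -/
abbrev FittSummand {R : Type*} [CommRing R] {m n : Type*} (φ : Matrix m n R) (j : ℕ) :
    Type _ :=
  ↥(minorIdeal φ j) ⧸ (minorIdeal φ (j + 1)).submoduleOf (minorIdeal φ j)

/-- The Fitting module `⨁_{j=0}^{N} Fitt_{N-j}(M) / Fitt_{N-j-1}(M)` of the module `M` presented by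
the matrix `φ` with `N` rows (generators of `M`), where `Fitt_{N-j}(M) = I_j(φ)`. -/
abbrev FittModule {R : Type*} [CommRing R] {m n : Type*} [Fintype m] (φ : Matrix m n R) :
    Type _ :=
  ⨁ j : Fin (Fintype.card m + 1), FittSummand φ j

/-- The class of an element of `I_j(φ)` in the summand `I_j(φ) / I_{j+1}(φ)` of the Fitting module.
(For `j` larger than the number of rows, `I_j(φ) = 0` and there is no such summand.) -/
noncomputable def fittClass {R : Type*} [CommRing R] {m n : Type*} [Fintype m]
    (φ : Matrix m n R) (j : ℕ) : ↥(minorIdeal φ j) →ₗ[R] FittModule φ :=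
  if h : j < Fintype.card m + 1 then
    (DirectSum.lof R (Fin (Fintype.card m + 1)) (fun j => FittSummand φ j) ⟨j, h⟩) ∘ₗ
      ((minorIdeal φ (j + 1)).submoduleOf (minorIdeal φ j)).mkQ
  else 0

/-- The presentation matrix `diag(ℓ_1, …, ℓ_n)` of `R/(ℓ_1) ⊕ ⋯ ⊕ R/(ℓ_n)`, where the `ℓ_j` are the
linear forms dual to the columns of `G`. -/
noncomputable abbrev codePresentation {K : Type*} [Field K] {σ ι : Type*} [Fintype σ]
    [DecidableEq ι] (G : Matrix σ ι K) : Matrix ι ι (MvPolynomial σ K) :=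
  Matrix.diagonal (columnForms G)

/-- The Fitting module of the code with generating matrix `G`, as a module over the polynomial ring
whose variables are indexed by the rows of `G`. -/
abbrev CodeFitt {K : Type*} [Field K] {σ ι : Type*} [Fintype σ] [Fintype ι] [DecidableEq ι]
    (G : Matrix σ ι K) : Type _ :=
  FittModule (codePresentation G)

/-! ## Gradings -/

/-- The homogeneous polynomials of degree `d ∈ ℤ` (only `0` if `d < 0`). -/
noncomputable def polyGrading (K : Type*) [Field K] (σ : Type*) (d : ℤ) :
    Submodule K (MvPolynomial σ K) :=
  if 0 ≤ d then MvPolynomial.homogeneousSubmodule σ K d.toNat else ⊥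

/-- The degree `d` part of the Fitting module: every component in `I_j / I_{j+1}` is the class of a
homogeneous polynomial of degree `d` in `I_j`. -/
noncomputable def fittGrading {K : Type*} [Field K] {σ ι : Type*} [Fintype σ] [Fintype ι]
    [DecidableEq ι] (G : Matrix σ ι K) (d : ℤ) : Submodule K (CodeFitt G) where
  carrier := {u | ∀ j : Fin (Fintype.card ι + 1), ∃ x : ↥(minorIdeal (codePresentation G) j),
    (x : MvPolynomial σ K) ∈ polyGrading K σ d ∧ u j = Submodule.Quotient.mk x}
  add_mem' := by
    intro a b ha hb j
    obtain ⟨x, hx, hx'⟩ := ha j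
    obtain ⟨y, hy, hy'⟩ := hb j
    exact ⟨x + y, add_mem hx hy, by rw [DirectSum.add_apply, hx', hy', Submodule.Quotient.mk_add]⟩
  zero_mem' := fun j => ⟨0, zero_mem _, by rw [DirectSum.zero_apply, Submodule.Quotient.mk_zero]⟩
  smul_mem' := by
    intro c a ha j
    obtain ⟨x, hx, hx'⟩ := ha j
    exact ⟨c • x, Submodule.smul_mem _ c hx, by
      rw [DirectSum.smul_apply, hx', Submodule.Quotient.mk_smul]⟩

/-- The grading of the twist `M(e)` of a graded module `M`: `M(e)_d = M_{d+e}`. -/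
def twist {K M : Type*} [Field K] [AddCommGroup M] [Module K M]
    (𝒜 : ℤ → Submodule K M) (e : ℤ) : ℤ → Submodule K M :=
  fun d => 𝒜 (d + e)

/-! Write `I a`, `I' a`, `I'' a` for the minor ideals of the code, its deletion and its restriction,
`l` for the form of the removed column, and `π` for the map to the smaller polynomial ring. The
minors of a diagonal matrix reduce these ideals to ideals of products of `a` distinct column forms.
Sorting products by whether they contain `l` gives `I (a+1) = I' (a+1) + l * I' a`, and `π` maps `I'
a` onto `I'' a`.

Everything then rests on one colon bound: if `l * z ∈ I' (a+1)`, then `z ∈ I' a`. With the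
decomposition it upgrades to: if `l * z ∈ I (a+1)`, then `z ∈ I' a`. This is injectivity of
multiplication by `l`. It also gives exactness in the middle: if `π x ∈ I'' (a+1)`, lift `π x` to `y
∈ I' (a+1)`; then `x - y = l * z` because `l` generates `ker π`, and the upgraded bound places `z`
in the correct ideal of the deletion. Surjectivity is the lifting itself.

The MDS property enters as the statement that any `k` columns span (`IsMDS.span_columns_eq_top`).
The colon bound (`mem_productIdeal_of_linearForm_mul_mem`) has two regimes. When `a` is small
compared with the number of remaining columns, `I' (a+1)` is a power of the irrelevant ideal
(`productIdeal_eq_pow_idealOfVars`), and additivity of the order of vanishing suffices. Otherwise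
`l` is a nonzerodivisor modulo `I' (a+1)` (`mem_of_mul_mem_span_sup_productIdeal`), by induction on
the family of forms. -/

/-! ## Ideals of products of `a` elements of a family -/

section ProductIdeal

variable {R S : Type*} [CommRing R] [CommRing S] {ι κ : Type*}

/-- The ideal generated by the products of `a` members, with distinct indices in `A`, of the
family `l`. -/
def productIdeal (l : ι → R) (A : Finset ι) (a : ℕ) : Ideal R :=
  Ideal.span {x | ∃ T ⊆ A, T.card = a ∧ x = ∏ j ∈ T, l j}

theorem prod_mem_productIdeal (l : ι → R) {A T : Finset ι} (hT : T ⊆ A) :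
    ∏ j ∈ T, l j ∈ productIdeal l A T.card :=
  Ideal.subset_span ⟨T, hT, rfl, rfl⟩

theorem productIdeal_zero (l : ι → R) (A : Finset ι) : productIdeal l A 0 = ⊤ := by
  rw [Ideal.eq_top_iff_one]
  simpa using prod_mem_productIdeal l (Finset.empty_subset A)

theorem productIdeal_eq_bot (l : ι → R) {A : Finset ι} {a : ℕ} (h : A.card < a) :
    productIdeal l A a = ⊥ := by
  rw [productIdeal, Ideal.span_eq_bot]
  rintro x ⟨T, hT, rfl, -⟩
  exact absurd (Finset.card_le_card hT) (by omega)

theorem productIdeal_succ_le (l : ι → R) (A : Finset ι) (a : ℕ) :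
    productIdeal l A (a + 1) ≤ productIdeal l A a := by
  classical
  rw [productIdeal, Ideal.span_le]
  rintro x ⟨T, hT, hc, rfl⟩
  obtain ⟨j, hj⟩ : T.Nonempty := Finset.card_pos.mp (by omega)
  rw [← Finset.mul_prod_erase T l hj]
  refine Ideal.mul_mem_left _ _ ?_
  have := prod_mem_productIdeal l ((Finset.erase_subset j T).trans hT)
  rwa [Finset.card_erase_of_mem hj, hc, Nat.add_sub_cancel] at this

theorem productIdeal_mono (l : ι → R) {A B : Finset ι} (h : A ⊆ B) (a : ℕ) :
    productIdeal l A a ≤ productIdeal l B a :=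
  Ideal.span_mono fun _ ⟨T, hT, hx⟩ => ⟨T, hT.trans h, hx⟩

theorem mul_mem_productIdeal_insert [DecidableEq ι] (l : ι → R) {A : Finset ι} {i : ι}
    (hi : i ∉ A) {a : ℕ} {x : R} (hx : x ∈ productIdeal l A a) :
    l i * x ∈ productIdeal l (insert i A) (a + 1) := by
  refine Submodule.span_induction ?_ (by simp) ?_ ?_ hx
  · rintro x ⟨T, hT, rfl, rfl⟩
    rw [← Finset.prod_insert fun h => hi (hT h), ← Finset.card_insert_of_notMem fun h => hi (hT h)]
    exact prod_mem_productIdeal l (Finset.insert_subset_insert i hT)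
  · intro x y _ _ hx hy
    rw [mul_add]
    exact add_mem hx hy
  · intro c x _ hx
    rw [smul_eq_mul, mul_left_comm]
    exact Ideal.mul_mem_left _ _ hx

theorem exists_of_mem_productIdeal_insert [DecidableEq ι] (l : ι → R) {A : Finset ι} {i : ι}
    {a : ℕ} {x : R} (hx : x ∈ productIdeal l (insert i A) (a + 1)) :
    ∃ y ∈ productIdeal l A (a + 1), ∃ z ∈ productIdeal l A a, x = y + l i * z := by
  refine Submodule.span_induction ?_ ⟨0, zero_mem _, 0, zero_mem _, by simp⟩ ?_ ?_ hx
  · rintro x ⟨T, hT, hc, rfl⟩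
    by_cases hiT : i ∈ T
    · refine ⟨0, zero_mem _, ∏ j ∈ T.erase i, l j, ?_, by rw [zero_add, Finset.mul_prod_erase T l hiT]⟩
      have := prod_mem_productIdeal l (Finset.subset_insert_iff.mp hT)
      rwa [Finset.card_erase_of_mem hiT, hc, Nat.add_sub_cancel] at this
    · refine ⟨∏ j ∈ T, l j, ?_, 0, zero_mem _, by simp⟩
      rw [← hc]
      exact prod_mem_productIdeal l ((Finset.subset_insert_iff_of_notMem hiT).mp hT)
  · rintro _ _ _ _ ⟨y, hy, z, hz, rfl⟩ ⟨y', hy', z', hz', rfl⟩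
    exact ⟨y + y', add_mem hy hy', z + z', add_mem hz hz', by ring⟩
  · rintro c _ _ ⟨y, hy, z, hz, rfl⟩
    exact ⟨c * y, Ideal.mul_mem_left _ _ hy, c * z, Ideal.mul_mem_left _ _ hz, by
      rw [smul_eq_mul]; ring⟩

theorem productIdeal_comp (l : ι → R) (e : κ ↪ ι) (A : Finset κ) (a : ℕ) :
    productIdeal (fun j => l (e j)) A a = productIdeal l (A.map e) a := by
  apply le_antisymm
  · refine Ideal.span_mono ?_
    rintro x ⟨T, hT, hc, rfl⟩
    exact ⟨T.map e, Finset.map_subset_map.mpr hT, by simpa using hc, by simp⟩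
  · refine Ideal.span_mono ?_
    rintro x ⟨T, hT, hc, rfl⟩
    obtain ⟨U, hU, rfl⟩ := Finset.subset_map_iff.mp hT
    exact ⟨U, hU, by simpa using hc, by simp⟩

theorem map_productIdeal (f : R →+* S) (l : ι → R) (A : Finset ι) (a : ℕ) :
    (productIdeal l A a).map f = productIdeal (fun j => f (l j)) A a := by
  rw [productIdeal, Ideal.map_span, productIdeal]
  congr 1
  ext x
  constructor
  · rintro ⟨_, ⟨T, hT, hc, rfl⟩, rfl⟩
    exact ⟨T, hT, hc, map_prod f _ _⟩
  · rintro ⟨T, hT, hc, rfl⟩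
    exact ⟨_, ⟨T, hT, hc, rfl⟩, map_prod f _ _⟩

/-- Each term of a Leibniz expansion with distinct rows is zero or, up to sign, a product of
distinct diagonal entries; a repeated row makes the determinant vanish. Conversely, principal minors
realize all such products. -/
theorem minorIdeal_diagonal [Fintype ι] [DecidableEq ι] (l : ι → R) (a : ℕ) :
    minorIdeal (Matrix.diagonal l) a = productIdeal l Finset.univ a := by
  apply le_antisymm
  · rw [minorIdeal, Ideal.span_le]
    rintro x ⟨r, c, rfl⟩
    by_cases hr : Function.Injective r
    · rw [Matrix.det_apply]
      refine Submodule.sum_mem _ fun s _ => Submodule.smul_of_tower_mem _ _ ?_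
      by_cases hs : ∀ b, r (s b) = c b
      · have h := prod_mem_productIdeal l
          (Finset.subset_univ (Finset.univ.map ⟨fun b => r (s b), hr.comp s.injective⟩))
        simpa [Matrix.diagonal, hs] using h
      · push Not at hs
        obtain ⟨b, hb⟩ := hs
        rw [Finset.prod_eq_zero (Finset.mem_univ b) (by simp [Matrix.diagonal, hb])]
        exact zero_mem _
    · simp only [Function.Injective, not_forall] at hr
      obtain ⟨b, b', hb, hne⟩ := hr
      rw [Matrix.det_zero_of_row_eq hne (by ext; simp [hb])]
      exact zero_mem _
  · rw [productIdeal, Ideal.span_le]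
    rintro x ⟨T, -, rfl, rfl⟩
    refine Ideal.subset_span ⟨fun b => (T.equivFin.symm b).1, fun b => (T.equivFin.symm b).1, ?_⟩
    rw [Matrix.submatrix_diagonal l (fun b => (T.equivFin.symm b).1)
      (Subtype.val_injective.comp T.equivFin.symm.injective), Matrix.det_diagonal]
    simp only [Function.comp_apply]
    rw [T.equivFin.symm.prod_comp (fun j => l j.1), Finset.prod_coe_sort T l]

/-- If `l i` is a nonzerodivisor modulo any fewer than `k` other members of the family `l`, then it
is a nonzerodivisor modulo the ideal of products of `a` out of at most `a + c - 1` members and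
`q < k - c` further members. -/
theorem mem_of_mul_mem_span_sup_productIdeal [DecidableEq ι] {l : ι → R} {k : ℕ}
    (hl : ∀ (Q : Finset ι) (i : ι), i ∉ Q → Q.card + 1 ≤ k → ∀ z : R,
      l i * z ∈ Ideal.span (l '' Q) → z ∈ Ideal.span (l '' Q))
    (A : Finset ι) : ∀ (Q : Finset ι) (i : ι) (a c : ℕ), i ∉ A → i ∉ Q → Disjoint A Q →
      A.card + 1 ≤ c + a → c + Q.card + 1 ≤ k → ∀ z : R,
      l i * z ∈ Ideal.span (l '' Q) ⊔ productIdeal l A a →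
      z ∈ Ideal.span (l '' Q) ⊔ productIdeal l A a := by
  induction A using Finset.induction_on with
  | empty =>
    intro Q i a c _ hiQ _ hA hk z hz
    rcases a with _ | a
    · simp [productIdeal_zero]
    · rw [productIdeal_eq_bot l (by simp), sup_bot_eq] at hz ⊢
      exact hl Q i hiQ (by omega) z hz
  | insert h A hhA ih =>
    intro Q i a c hiA hiQ hdisj hA hk z hz
    rcases a with _ | a
    · simp [productIdeal_zero]
    -- For `c = 0` the degree exceeds the size of the family, so there are no products and only the
    -- linear part is left.
    rcases c with _ | c
    · rw [productIdeal_eq_bot l (by omega), sup_bot_eq] at hz ⊢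
      exact hl Q i hiQ (by omega) z hz
    rw [Finset.mem_insert, not_or] at hiA
    rw [Finset.disjoint_insert_left] at hdisj
    rw [Finset.card_insert_of_notMem hhA] at hA
    have hspan : Ideal.span (l '' (insert h Q : Finset ι)) =
        Ideal.span {l h} ⊔ Ideal.span (l '' Q) := by
      rw [Finset.coe_insert, Set.image_insert_eq, Ideal.span_insert]
    -- Once `l h` joins the linear part, products containing it are absorbed: `A` loses `h`, `Q`
    -- gains it, and `c` drops by one. Induction then gives `z = w * l h + y`, and it remains to
    -- control `w`.
    have hz' : l i * z ∈ Ideal.span (l '' (insert h Q : Finset ι)) ⊔ productIdeal l A (a + 1) := by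
      obtain ⟨u, hu, v, hv, huv⟩ := Submodule.mem_sup.mp hz
      obtain ⟨y, hy, w, -, rfl⟩ := exists_of_mem_productIdeal_insert l hv
      rw [← huv, add_comm y, ← add_assoc, hspan]
      refine add_mem (Ideal.mem_sup_left (add_mem (Ideal.mem_sup_right hu)
        (Ideal.mem_sup_left ?_))) (Ideal.mem_sup_right hy)
      exact Ideal.mul_mem_right _ _ (Ideal.mem_span_singleton_self _)
    have hcard : (insert h Q).card = Q.card + 1 := Finset.card_insert_of_notMem hdisj.1
    have hzq := ih (insert h Q) i (a + 1) c hiA.2 (by simp [hiA.1, hiQ])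
      (by simp [Finset.disjoint_insert_right, hhA, hdisj.2]) (by omega) (by omega) z hz'
    rw [hspan, sup_assoc] at hzq
    obtain ⟨_, hw, y, hy, rfl⟩ := Submodule.mem_sup.mp hzq
    obtain ⟨w, rfl⟩ := Ideal.mem_span_singleton'.mp hw
    have hle : Ideal.span (l '' Q) ⊔ productIdeal l (insert h A) (a + 1) ≤
        Ideal.span (l '' Q) ⊔ productIdeal l A a := by
      refine sup_le le_sup_left fun x hx => ?_
      obtain ⟨y, hy, w, hw, rfl⟩ := exists_of_mem_productIdeal_insert l hx
      exact Ideal.mem_sup_right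
        (add_mem (productIdeal_succ_le l A a hy) (Ideal.mul_mem_left _ _ hw))
    have hyle : y ∈ Ideal.span (l '' Q) ⊔ productIdeal l A a :=
      sup_le_sup_left (productIdeal_succ_le l A a) _ hy
    -- Lowering the degree to `a` gives an ideal for which the induction hypothesis applies to both
    -- `l h` and `l i`. Cancelling both puts `w` there, and multiplying back by `l h` restores the
    -- lost degree.
    have hw1 : l h * (l i * w) ∈ Ideal.span (l '' Q) ⊔ productIdeal l A a := by
      have := sub_mem (hle hz) (Ideal.mul_mem_left _ (l i) hyle)
      convert this using 1
      ring
    have hw2 := ih Q i a (c + 1) hiA.2 hiQ hdisj.2 (by omega) (by omega) w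
      (ih Q h a (c + 1) hhA hdisj.1 hdisj.2 (by omega) (by omega) _ hw1)
    obtain ⟨u, hu, v, hv, rfl⟩ := Submodule.mem_sup.mp hw2
    have h1 : y ∈ Ideal.span (l '' Q) ⊔ productIdeal l (insert h A) (a + 1) :=
      sup_le_sup_left (productIdeal_mono l (Finset.subset_insert h A) _) _ hy
    refine add_mem ?_ h1
    rw [add_mul, mul_comm v]
    exact add_mem (Ideal.mem_sup_left (Ideal.mul_mem_right _ _ hu))
      (Ideal.mem_sup_right (mul_mem_productIdeal_insert l hhA hv))

end ProductIdeal

/-! ## Linear forms -/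

section LinearForm

variable {K : Type*} [Field K] {σ ι : Type*} [Fintype σ]

/-- `linearForm` as a linear map. -/
noncomputable def linearFormMap (K σ : Type*) [Field K] [Fintype σ] :
    (σ → K) →ₗ[K] MvPolynomial σ K :=
  Fintype.linearCombination K (MvPolynomial.X : σ → MvPolynomial σ K)

theorem linearFormMap_apply (v : σ → K) : linearFormMap K σ v = linearForm v := by
  simp [linearFormMap, linearForm, Fintype.linearCombination_apply, MvPolynomial.smul_eq_C_mul]

theorem linearForm_isHomogeneous (v : σ → K) : (linearForm v).IsHomogeneous 1 :=
  MvPolynomial.IsHomogeneous.sum _ _ _ fun s _ => by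
    simpa using (MvPolynomial.isHomogeneous_C σ (v s)).mul (MvPolynomial.isHomogeneous_X K s)

theorem linearForm_single [DecidableEq σ] (s : σ) :
    linearForm (Pi.single s (1 : K)) = MvPolynomial.X s := by
  rw [linearForm, Finset.sum_eq_single s] <;> simp +contextual

theorem linearForm_injective : Function.Injective (linearForm : (σ → K) → MvPolynomial σ K) := by
  classical
  intro v w h
  ext s
  have := congrArg (MvPolynomial.coeff (Finsupp.single s 1)) h
  simpa [linearForm, MvPolynomial.coeff_sum, MvPolynomial.coeff_C_mul, MvPolynomial.coeff_X,
    Finsupp.single_left_inj] using this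

theorem linearForm_zero : linearForm (0 : σ → K) = 0 := by
  simp [linearForm]

theorem linearForm_ne_zero {v : σ → K} (hv : v ≠ 0) : linearForm v ≠ 0 := by
  rw [← linearForm_zero]
  exact linearForm_injective.ne hv

theorem aeval_linearForm {B : Type*} [CommRing B] [Algebra K B] (g : σ → B) (v : σ → K) :
    MvPolynomial.aeval g (linearForm v) = ∑ s, v s • g s := by
  simp [linearForm, map_sum, Algebra.smul_def]

theorem sum_smul_linearForm {κ : Type*} [Fintype κ] (c : κ → K) (v : κ → σ → K) :
    ∑ j, c j • linearForm (v j) = linearForm (∑ j, c j • v j) := by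
  simp only [← linearFormMap_apply, map_sum, map_smul]

/-- An endomorphism of a polynomial ring that fixes the variables modulo an ideal fixes everything
modulo that ideal. -/
theorem algHom_sub_self_mem {σ : Type*} {I : Ideal (MvPolynomial σ K)}
    (φ : MvPolynomial σ K →ₐ[K] MvPolynomial σ K)
    (h : ∀ s, φ (MvPolynomial.X s) - MvPolynomial.X s ∈ I) (z : MvPolynomial σ K) :
    φ z - z ∈ I := by
  have : (Ideal.Quotient.mkₐ K I).comp φ = Ideal.Quotient.mkₐ K I :=
    MvPolynomial.algHom_ext fun s => by
      simpa using (Ideal.Quotient.mk_eq_mk_iff_sub_mem _ _).mpr (h s)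
  exact (Ideal.Quotient.mk_eq_mk_iff_sub_mem _ _).mp (DFunLike.congr_fun this z)

theorem linearForm_mem_span_image (v : ι → σ → K) (Q : Set ι) {w : σ → K}
    (hw : w ∈ Submodule.span K (v '' Q)) :
    linearForm w ∈ Ideal.span ((fun j => linearForm (v j)) '' Q) := by
  refine Submodule.span_induction ?_ ?_ ?_ ?_ hw
  · rintro _ ⟨j, hj, rfl⟩
    exact Ideal.subset_span ⟨j, hj, rfl⟩
  · rw [linearForm_zero]
    exact zero_mem _
  · intro x y _ _ hx hy
    rw [← linearFormMap_apply, map_add, linearFormMap_apply, linearFormMap_apply]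
    exact add_mem hx hy
  · intro c x _ hx
    rw [← linearFormMap_apply, map_smul, linearFormMap_apply]
    exact Submodule.smul_of_tower_mem _ c hx

/-- A linear form outside the span of some linear forms is a nonzerodivisor modulo the ideal that
they generate. -/
theorem mem_span_of_linearForm_mul_mem [DecidableEq σ] (v : ι → σ → K) (Q : Set ι) {w : σ → K}
    (hw : w ∉ Submodule.span K (v '' Q)) {z : MvPolynomial σ K}
    (hz : linearForm w * z ∈ Ideal.span ((fun j => linearForm (v j)) '' Q)) :
    z ∈ Ideal.span ((fun j => linearForm (v j)) '' Q) := by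
  set W := Submodule.span K (v '' Q) with hW
  -- Projecting along `W` induces an endomorphism `φ` that kills the ideal and is the identity
  -- modulo it. Since `φ` lands in a domain and does not kill the form of `w`, it must kill `z`.
  obtain ⟨W', hW'⟩ := W.exists_isCompl
  set P : (σ → K) →ₗ[K] (σ → K) := W'.projection W hW'.symm with hP
  have hPW : ∀ u, P u - u ∈ W := fun u => by
    rw [← neg_sub]
    exact neg_mem (Submodule.sub_projection_mem hW'.symm u)
  have hP0 : ∀ u, P u = 0 ↔ u ∈ W := fun u => Submodule.projection_apply_eq_zero_iff hW'.symm
  let φ : MvPolynomial σ K →ₐ[K] MvPolynomial σ K :=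
    MvPolynomial.aeval fun s => linearForm (P (Pi.single s 1))
  have hφ : ∀ u, φ (linearForm u) = linearForm (P u) := fun u => by
    rw [aeval_linearForm, sum_smul_linearForm]
    congr 1
    conv_rhs => rw [pi_eq_sum_univ' u]
    rw [map_sum]
    refine Finset.sum_congr rfl fun s _ => ?_
    rw [map_smul]
  have hφz : φ z - z ∈ Ideal.span ((fun j => linearForm (v j)) '' Q) := by
    refine algHom_sub_self_mem φ (fun s => ?_) z
    rw [← linearForm_single, hφ, ← linearFormMap_apply, ← linearFormMap_apply, ← map_sub,
      linearFormMap_apply]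
    exact linearForm_mem_span_image v Q (hPW _)
  have hker : Ideal.span ((fun j => linearForm (v j)) '' Q) ≤ RingHom.ker φ := by
    rw [Ideal.span_le]
    rintro _ ⟨j, hj, rfl⟩
    rw [SetLike.mem_coe, RingHom.mem_ker, hφ, (hP0 _).mpr (Submodule.subset_span ⟨j, hj, rfl⟩),
      linearForm_zero]
  have h0 := hker hz
  rw [RingHom.mem_ker, map_mul, hφ, mul_eq_zero] at h0
  rcases h0 with h0 | h0
  · exact absurd h0 (linearForm_ne_zero fun h => hw ((hP0 _).mp h))
  · simpa [h0] using hφz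

end LinearForm

/-! ## Powers of the irrelevant ideal -/

section Generic

variable {K : Type*} [Field K] {σ ι : Type*} [Fintype σ]

open MvPolynomial in
-- Passing to power series makes additivity of the order under multiplication available; a nonzero
-- linear form has order at most one.
theorem mem_pow_idealOfVars_iff_le_order {σ : Type*} {z : MvPolynomial σ K} {a : ℕ} :
    z ∈ idealOfVars σ K ^ a ↔ (a : ℕ∞) ≤ (z : MvPowerSeries σ K).order := by
  rw [mem_pow_idealOfVars_iff']
  constructor
  · intro h
    exact MvPowerSeries.nat_le_order fun d hd => by simpa using h d hd
  · intro h x hx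
    rw [← coeff_coe]
    exact MvPowerSeries.coeff_of_lt_order (lt_of_lt_of_le (by exact_mod_cast hx) h)

open MvPolynomial in
theorem mem_pow_idealOfVars_of_linearForm_mul_mem {v : σ → K} (hv : v ≠ 0)
    {z : MvPolynomial σ K} {a : ℕ} (hz : linearForm v * z ∈ idealOfVars σ K ^ (a + 1)) :
    z ∈ idealOfVars σ K ^ a := by
  classical
  rw [mem_pow_idealOfVars_iff_le_order] at hz ⊢
  obtain ⟨s, hs⟩ := Function.ne_iff.mp hv
  have hle : (linearForm v : MvPowerSeries σ K).order ≤ 1 := by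
    have hc : MvPowerSeries.coeff (Finsupp.single s 1) (linearForm v : MvPowerSeries σ K) ≠ 0 := by
      simpa [linearForm, coeff_sum, coeff_C_mul, coeff_X, Finsupp.single_left_inj] using hs
    simpa using MvPowerSeries.order_le hc
  rw [coe_mul, MvPowerSeries.order_mul] at hz
  have h := hz.trans (add_le_add_left hle _)
  push_cast at h
  rw [add_comm] at h
  exact (ENat.add_le_add_iff_left ENat.one_ne_top).mp h

open MvPolynomial in
theorem productIdeal_le_pow_idealOfVars (v : ι → σ → K) (A : Finset ι) (a : ℕ) :
    productIdeal (fun j => linearForm (v j)) A a ≤ idealOfVars σ K ^ a := by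
  rw [productIdeal, Ideal.span_le]
  rintro x ⟨T, -, rfl, rfl⟩
  rw [← Finset.prod_const]
  refine Ideal.prod_mem_prod fun j _ => Ideal.sum_mem _ fun s _ => Ideal.mul_mem_left _ _ ?_
  exact Ideal.subset_span ⟨s, rfl⟩

open MvPolynomial in
/-- If any `card σ` members of a family of vectors span, then the products of `a` out of at least
`a + card σ - 1` dual linear forms generate the `a`-th power of the irrelevant ideal. -/
theorem productIdeal_eq_pow_idealOfVars [DecidableEq σ] [DecidableEq ι] {v : ι → σ → K}
    (hv : ∀ T : Finset ι, Fintype.card σ ≤ T.card → Submodule.span K (v '' T) = ⊤)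
    {A : Finset ι} {a : ℕ} (hA : a + Fintype.card σ ≤ A.card + 1) :
    productIdeal (fun j => linearForm (v j)) A a = idealOfVars σ K ^ a := by
  refine le_antisymm (productIdeal_le_pow_idealOfVars v A a) ?_
  induction a with
  | zero => simp [productIdeal_zero]
  | succ a ih =>
    rw [pow_succ]
    refine (Ideal.mul_mono_left (ih (by omega))).trans ?_
    rw [productIdeal, idealOfVars, Ideal.span_mul_span', Ideal.span_le]
    rintro _ ⟨_, ⟨T, hT, hc, rfl⟩, _, ⟨s, rfl⟩, rfl⟩
    -- At least `card σ` members remain outside `T`, so the variable `x_s` is a combination of their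
    -- forms, and each of these extends the product over `T` by a new index.
    have htop : Pi.single s (1 : K) ∈ Submodule.span K (v '' (A \ T : Finset ι)) := by
      rw [hv _ (by rw [Finset.card_sdiff_of_subset hT]; omega)]
      trivial
    have hX := linearForm_mem_span_image v _ htop
    rw [linearForm_single] at hX
    have hle : Ideal.span ((fun j => linearForm (v j)) '' (A \ T : Finset ι)) ≤
        (productIdeal (fun j => linearForm (v j)) A (a + 1)).colon
          {∏ j ∈ T, linearForm (v j)} := by
      rw [Ideal.span_le]
      rintro _ ⟨j, hj, rfl⟩
      rw [Finset.mem_coe, Finset.mem_sdiff] at hj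
      rw [SetLike.mem_coe, Submodule.mem_colon_singleton, smul_eq_mul]
      have := prod_mem_productIdeal (fun j => linearForm (v j)) (Finset.insert_subset hj.1 hT)
      rwa [Finset.prod_insert hj.2, Finset.card_insert_of_notMem hj.2, hc] at this
    have := Submodule.mem_colon_singleton.mp (hle hX)
    rwa [smul_eq_mul, mul_comm] at this

/-- If any `card σ` members of a family of vectors span, then no member is in the span of fewer than
`card σ` others. -/
theorem notMem_span_image_of_span_eq_top [DecidableEq ι] {v : ι → σ → K}
    (hv : ∀ T : Finset ι, Fintype.card σ ≤ T.card → Submodule.span K (v '' T) = ⊤)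
    {B : Finset ι} (hB : Fintype.card σ ≤ B.card) (Q : Finset ι) (i : ι) (hiQ : i ∉ Q)
    (hQ : Q.card + 1 ≤ Fintype.card σ) : v i ∉ Submodule.span K (v '' Q) := by
  intro hmem
  -- `B` only serves as a reservoir of indices for completing `insert i Q` to exactly `card σ`
  -- members. If `v i` were redundant, fewer than `card σ` vectors would span.
  obtain ⟨T, hQT, hT⟩ : ∃ T : Finset ι, insert i Q ⊆ T ∧ T.card = Fintype.card σ := by
    have hc := Finset.card_insert_of_notMem hiQ
    obtain ⟨T, hT, -, hTc⟩ := Finset.exists_subsuperset_card_eq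
      (Finset.subset_union_left (s₁ := insert i Q) (s₂ := B)) (n := Fintype.card σ) (by omega)
      (hB.trans (Finset.card_le_card Finset.subset_union_right))
    exact ⟨T, hT, hTc⟩
  have hiT : i ∈ T := hQT (Finset.mem_insert_self i Q)
  have htop : Submodule.span K (v '' (T.erase i : Finset ι)) = ⊤ := by
    rw [eq_top_iff, ← hv T hT.ge, Submodule.span_le]
    rintro _ ⟨j, hj, rfl⟩
    by_cases hji : j = i
    · subst hji
      refine Submodule.span_mono (Set.image_mono ?_) hmem
      intro q hq
      exact Finset.mem_erase.mpr
        ⟨fun h => hiQ (h ▸ hq), hQT (Finset.mem_insert_of_mem hq)⟩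
    · exact Submodule.subset_span ⟨j, Finset.mem_erase.mpr ⟨hji, hj⟩, rfl⟩
  classical
  have hfin := finrank_span_finset_le_card (R := K) ((T.erase i).image v)
  rw [Finset.coe_image, Set.finrank, htop, finrank_top, Module.finrank_fintype_fun_eq_card] at hfin
  have := Finset.card_image_le (s := T.erase i) (f := v)
  rw [Finset.card_erase_of_mem hiT] at this
  omega

/-- For vectors any `card σ` of which span, a dual linear form `l i` and the ideals `I a` of
products of `a` other forms satisfy `I (a + 1) : l i ≤ I a`. -/
theorem mem_productIdeal_of_linearForm_mul_mem [DecidableEq σ] [DecidableEq ι] {v : ι → σ → K}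
    (hv : ∀ T : Finset ι, Fintype.card σ ≤ T.card → Submodule.span K (v '' T) = ⊤)
    {A B : Finset ι} {i : ι} (hi : i ∉ A) (hσ : 0 < Fintype.card σ)
    (hB : Fintype.card σ ≤ B.card) {a : ℕ} {z : MvPolynomial σ K}
    (hz : linearForm (v i) * z ∈ productIdeal (fun j => linearForm (v j)) A (a + 1)) :
    z ∈ productIdeal (fun j => linearForm (v j)) A a := by
  have hind := notMem_span_image_of_span_eq_top hv hB
  by_cases ha : a + Fintype.card σ ≤ A.card
  · rw [productIdeal_eq_pow_idealOfVars hv (by omega)] at hz ⊢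
    refine mem_pow_idealOfVars_of_linearForm_mul_mem (fun h => ?_) hz
    exact hind ∅ i (by simp) (by simp; omega) (h ▸ zero_mem _)
  -- Here `A.card - a < card σ`, so the nonzerodivisor lemma applies with `Q = ∅` and `c = A.card -
  -- a`. It even yields membership in degree `a + 1`.
  · refine productIdeal_succ_le _ _ _ ?_
    have := mem_of_mul_mem_span_sup_productIdeal (l := fun j => linearForm (v j))
      (k := Fintype.card σ)
      (fun Q i hiQ hQ z hz => mem_span_of_linearForm_mul_mem v Q (hind Q i hiQ hQ) hz)
      A ∅ i (a + 1) (A.card - a) hi (by simp) (by simp) (by omega) (by simp; omega) z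
    simpa using this (by simpa using hz)

end Generic

/-! ## MDS codes -/

section MDS

variable {K : Type*} [Field K] {n k : ℕ}

/-- Any `k` columns of a generating matrix of an MDS code of dimension `k` span. -/
theorem IsMDS.span_columns_eq_top {C : Submodule K (Fin n → K)} (hC : IsMDS C)
    {G : Matrix (Fin k) (Fin n) K} (hG : IsGeneratingMatrix C G) (T : Finset (Fin n))
    (hT : k ≤ T.card) : Submodule.span K ((fun j s => G s j) '' T) = ⊤ := by
  classical
  by_contra hne
  -- Evaluating a functional that kills the columns in `T` on all columns gives a codeword vanishing
  -- on `T`. It is nonzero because the rows are independent, and its weight of at most `n - k`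
  -- contradicts the minimum distance.
  obtain ⟨f, hf, hfT⟩ := Submodule.exists_le_ker_of_lt_top _ (lt_top_iff_ne_top.mpr hne)
  set w : Fin k → K := fun s => f (Pi.single s 1) with hw
  have hfw : ∀ u, f u = ∑ s, w s * u s := fun u => by
    conv_lhs => rw [pi_eq_sum_univ' u]
    rw [map_sum]
    refine Finset.sum_congr rfl fun s _ => ?_
    rw [map_smul, smul_eq_mul, mul_comm]
  set c : Fin n → K := ∑ s, w s • G.row s with hc
  have hcj : ∀ j, c j = f (fun s => G s j) := fun j => by
    rw [hfw]
    simp [hc, Finset.sum_apply, Matrix.row]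
  have hc0 : c ≠ 0 := fun h => hf (LinearMap.ext fun u => by
    have := Fintype.linearIndependent_iff.mp hG.1 w h
    simp [hfw, this])
  have hcC : c ∈ C := by
    rw [← hG.2]
    exact Submodule.sum_mem _ fun s _ => Submodule.smul_mem _ _ (Submodule.subset_span ⟨s, rfl⟩)
  have hle : minDistance C ≤ hammingNorm c := Nat.sInf_le ⟨c, hcC, hc0, rfl⟩
  have hfin : Module.finrank K C = k := by
    rw [← hG.2, finrank_span_eq_card hG.1, Fintype.card_fin]
  have hsub : Finset.univ.filter (fun j => c j ≠ 0) ⊆ Tᶜ := fun j hj => by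
    rw [Finset.mem_compl]
    intro hjT
    refine (Finset.mem_filter.mp hj).2 ?_
    rw [hcj]
    exact hfT (Submodule.subset_span ⟨j, hjT, rfl⟩)
  have hcard := Finset.card_le_card hsub
  rw [Finset.card_compl, Fintype.card_fin] at hcard
  have hTn : T.card ≤ n := by simpa using Finset.card_le_univ T
  rw [IsMDS, hfin] at hC
  have : hammingNorm c ≤ n - T.card := hcard
  omega

theorem IsGeneratingMatrix.le {C : Submodule K (Fin n → K)}
    {G : Matrix (Fin k) (Fin n) K} (hG : IsGeneratingMatrix C G) : k ≤ n := by
  simpa using hG.1.fintype_card_le_finrank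

/-- The isomorphism between the lines spanned by `v` and `w` extends to an automorphism of the whole
space. -/
theorem exists_isUnit_mulVec_eq {σ : Type*} [Fintype σ] [DecidableEq σ] {v w : σ → K}
    (hv : v ≠ 0) (hw : w ≠ 0) : ∃ A : Matrix σ σ K, IsUnit A ∧ A.mulVec v = w := by
  obtain ⟨g, hg⟩ := Submodule.exists_linearEquiv_restrict_eq
    ((LinearEquiv.toSpanNonzeroSingleton K _ v hv).symm ≪≫ₗ
      LinearEquiv.toSpanNonzeroSingleton K _ w hw)
  refine ⟨LinearMap.toMatrix' g.toLinearMap, LinearMap.isUnit_toMatrix'_iff.mpr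
    ((Module.End.isUnit_iff _).mpr g.bijective), ?_⟩
  rw [LinearMap.toMatrix'_mulVec]
  have h := hg (LinearEquiv.toSpanNonzeroSingleton K _ v hv 1)
  rw [LinearEquiv.trans_apply, LinearEquiv.symm_apply_apply] at h
  simpa using h.symm

end MDS

/-! ## Restriction to a hyperplane -/

section Restriction

variable {K : Type*} [Field K] {σ ι : Type*} [Fintype σ]

theorem linearForm_mul_mem_polyGrading (v : σ → K) {d : ℤ} {x : MvPolynomial σ K}
    (hx : x ∈ polyGrading K σ (d - 1)) : linearForm v * x ∈ polyGrading K σ d := by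
  unfold polyGrading at *
  split_ifs at hx with hd
  · rw [if_pos (by omega)]
    rw [MvPolynomial.mem_homogeneousSubmodule] at *
    convert (linearForm_isHomogeneous v).mul hx using 1
    omega
  · rw [(Submodule.mem_bot K).mp hx, mul_zero]
    exact zero_mem _

variable [DecidableEq σ]

theorem restrictionHom_linearForm (A : Matrix σ σ K) (p : σ) (v : σ → K) :
    restrictionHom A p (linearForm v) = linearForm fun q => A.mulVec v q.1 := by
  rw [restrictionHom, aeval_linearForm, sum_smul_linearForm]
  congr 1
  ext q
  simp [Finset.sum_apply, Matrix.mulVec, dotProduct, mul_comm]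

theorem restrictionHom_columnForms (A : Matrix σ σ K) (p : σ) (G : Matrix σ ι K) (j : ι) :
    restrictionHom A p (columnForms G j) = linearForm fun q => (A * G) q.1 j := by
  rw [columnForms, restrictionHom_linearForm]
  rfl

variable {A : Matrix σ σ K} {p : σ} {v : σ → K}

theorem restrictionHom_linearForm_eq_zero (hv : A.mulVec v = Pi.single p 1) :
    restrictionHom A p (linearForm v) = 0 := by
  rw [restrictionHom_linearForm, hv, ← linearForm_zero]
  congr 1
  ext q
  simp [q.2]

theorem restrictionHom_linearForm_inv (hA : IsUnit A) (q : {q : σ // q ≠ p}) :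
    restrictionHom A p (linearForm (A⁻¹.mulVec (Pi.single q.1 1))) = MvPolynomial.X q := by
  rw [restrictionHom_linearForm, Matrix.mulVec_mulVec,
    Matrix.mul_nonsing_inv _ ((Matrix.isUnit_iff_isUnit_det A).mp hA), Matrix.one_mulVec,
    ← linearForm_single]
  congr 1
  ext q'
  simp [Pi.single_apply, Subtype.ext_iff]

theorem restrictionHom_surjective (hA : IsUnit A) : Function.Surjective (restrictionHom A p) := by
  rw [← AlgHom.range_eq_top, eq_top_iff, ← MvPolynomial.adjoin_range_X, Algebra.adjoin_le_iff]
  rintro _ ⟨q, rfl⟩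
  exact ⟨_, restrictionHom_linearForm_inv hA q⟩

theorem ker_restrictionHom (hA : IsUnit A) (hv : A.mulVec v = Pi.single p 1) :
    RingHom.ker (restrictionHom A p) = Ideal.span {linearForm v} := by
  have hdet := (Matrix.isUnit_iff_isUnit_det A).mp hA
  apply le_antisymm
  · intro z hz
    -- A section of the restriction built from `A⁻¹`. Composing back changes a linear form only by a
    -- multiple of the form of `v = A⁻¹ e_p`, so anything in the kernel is zero modulo that form.
    let s : MvPolynomial {q : σ // q ≠ p} K →ₐ[K] MvPolynomial σ K :=
      MvPolynomial.aeval fun q => linearForm (A⁻¹.mulVec (Pi.single q.1 1))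
    have hs : ∀ w, s (restrictionHom A p (linearForm w)) =
        linearForm w - A.mulVec w p • linearForm v := fun w => by
      rw [restrictionHom_linearForm, aeval_linearForm, sum_smul_linearForm]
      simp only [← linearFormMap_apply]
      rw [← map_smul, ← map_sub]
      congr 1
      have hinv : ∀ w, A⁻¹.mulVec (A.mulVec w) = w := fun w => by
        rw [Matrix.mulVec_mulVec, Matrix.nonsing_inv_mul _ hdet, Matrix.one_mulVec]
      have hsum : ∑ q : {q : σ // q ≠ p}, A.mulVec w q.1 • (Pi.single q.1 1 : σ → K) =
          A.mulVec w - A.mulVec w p • Pi.single p 1 := by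
        rw [eq_sub_iff_add_eq, ← Finset.sum_subtype (Finset.univ.erase p) (by simp)
          fun q => A.mulVec w q • (Pi.single q 1 : σ → K), Finset.sum_erase_add _ _ (Finset.mem_univ p)]
        exact (pi_eq_sum_univ' _).symm
      calc _ = A⁻¹.mulVec (∑ q : {q : σ // q ≠ p}, A.mulVec w q.1 • (Pi.single q.1 1 : σ → K)) := by
            simp only [Matrix.mulVec_sum, Matrix.mulVec_smul]
        _ = _ := by
            rw [hsum, ← hv, Matrix.mulVec_sub, Matrix.mulVec_smul, hinv, hinv]
    have h := algHom_sub_self_mem (I := Ideal.span {linearForm v})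
      (s.comp (restrictionHom A p)) (fun t => ?_) z
    · rw [AlgHom.comp_apply, RingHom.mem_ker.mp hz, map_zero, zero_sub] at h
      exact neg_mem_iff.mp h
    · rw [← linearForm_single, AlgHom.comp_apply, hs, sub_sub_cancel_left]
      exact neg_mem (Submodule.smul_of_tower_mem _ _ (Ideal.mem_span_singleton_self _))
  · rw [Ideal.span_singleton_le_iff_mem]
    exact restrictionHom_linearForm_eq_zero hv

theorem restrictionHom_mem_polyGrading {d : ℤ} {x : MvPolynomial σ K} (hx : x ∈ polyGrading K σ d) :
    restrictionHom A p x ∈ polyGrading K {q : σ // q ≠ p} d := by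
  unfold polyGrading at *
  split_ifs at * with hd
  · rw [MvPolynomial.mem_homogeneousSubmodule] at *
    rw [← one_mul d.toNat]
    exact hx.aeval _ fun j => linearForm_isHomogeneous _
  · rw [(Submodule.mem_bot K).mp hx, map_zero]
    exact zero_mem _

end Restriction

/-! ## The ideals of minors of a code, its deletion and its restriction -/

section MinorIdeal

variable {K : Type*} [Field K] {σ ι : Type*} [Fintype σ] [Fintype ι] [DecidableEq ι]

theorem minorIdeal_codePresentation (G : Matrix σ ι K) (a : ℕ) :
    minorIdeal (codePresentation G) a = productIdeal (columnForms G) Finset.univ a :=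
  minorIdeal_diagonal _ _

theorem map_subtype_univ_ne (i : ι) : (Finset.univ : Finset {j : ι // j ≠ i}).map
    (Function.Embedding.subtype _) = Finset.univ.erase i := by
  ext j
  simp

theorem minorIdeal_deletion (G : Matrix σ ι K) (i : ι) (a : ℕ) :
    minorIdeal (codePresentation (deletion G i)) a =
      productIdeal (columnForms G) (Finset.univ.erase i) a := by
  rw [minorIdeal_codePresentation, ← map_subtype_univ_ne, ← productIdeal_comp]
  rfl

/-- The restriction map carries each remaining column form to the corresponding form of the
restricted matrix. When `A` is invertible the map is onto, so elements on the restricted side lift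
to the deletion ideal of the same index. -/
theorem minorIdeal_restriction [DecidableEq σ] (G : Matrix σ ι K) (A : Matrix σ σ K) (p : σ) (i : ι) (a : ℕ) :
    minorIdeal (codePresentation (restriction (A * G) p i)) a =
      (productIdeal (columnForms G) (Finset.univ.erase i) a).map
        (restrictionHom A p : MvPolynomial σ K →+* MvPolynomial {q : σ // q ≠ p} K) := by
  rw [minorIdeal_codePresentation, map_productIdeal, ← map_subtype_univ_ne, ← productIdeal_comp]
  congr 1
  ext1 j
  exact (restrictionHom_columnForms A p G j.1).symm

end MinorIdeal

/-! ## Elements and maps of Fitting modules -/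

section Fitting

variable {R S : Type*} [CommRing R] [CommRing S] {m n m' n' : Type*}

theorem mk_eq_zero_iff (φ : Matrix m n R) {j : ℕ} (x : minorIdeal φ j) :
    (Submodule.Quotient.mk x : FittSummand φ j) = 0 ↔ (x : R) ∈ minorIdeal φ (j + 1) := by
  rw [Submodule.Quotient.mk_eq_zero]
  rfl

variable [Fintype m] [Fintype m']

theorem minorIdeal_eq_bot (φ : Matrix m n R) {j : ℕ} (hj : Fintype.card m < j) :
    minorIdeal φ j = ⊥ := by
  rw [minorIdeal, Ideal.span_eq_bot]
  rintro _ ⟨r, c, rfl⟩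
  have hr : ¬ Function.Injective r := fun h => by
    have := Fintype.card_le_of_injective r h
    rw [Fintype.card_fin] at this
    omega
  simp only [Function.Injective, not_forall] at hr
  obtain ⟨b, b', hb, hne⟩ := hr
  exact Matrix.det_zero_of_row_eq hne (by ext; simp [hb])

theorem fittClass_apply_self (φ : Matrix m n R) (t : Fin (Fintype.card m + 1))
    (x : minorIdeal φ t) : fittClass φ t x t = Submodule.Quotient.mk x := by
  rw [fittClass, dif_pos t.2]
  exact DirectSum.of_eq_same _ _

theorem fittClass_apply_of_ne (φ : Matrix m n R) {t : Fin (Fintype.card m + 1)} {j : ℕ}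
    (h : j ≠ t) (x : minorIdeal φ j) : fittClass φ j x t = 0 := by
  rw [fittClass]
  split_ifs with hj
  · exact DirectSum.of_eq_of_ne _ _ _ fun h' => h (congrArg Fin.val h').symm
  · rfl

theorem fittClass_eq_zero_iff (φ : Matrix m n R) (j : ℕ) (x : minorIdeal φ j) :
    fittClass φ j x = 0 ↔ (x : R) ∈ minorIdeal φ (j + 1) := by
  by_cases hj : j < Fintype.card m + 1
  · rw [← mk_eq_zero_iff, fittClass, dif_pos hj]
    exact (map_eq_zero_iff _ (DirectSum.of_injective (β := fun j : Fin (Fintype.card m + 1) =>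
      FittSummand φ j) ⟨j, hj⟩))
  · rw [fittClass, dif_neg hj]
    have : (x : R) ∈ (⊥ : Ideal R) := minorIdeal_eq_bot φ (j := j) (by omega) ▸ x.2
    rw [(Submodule.mem_bot R).mp this]
    simp

theorem fittClass_eq_iff (φ : Matrix m n R) {j : ℕ} {x y : minorIdeal φ j} :
    fittClass φ j x = fittClass φ j y ↔ (x : R) - y ∈ minorIdeal φ (j + 1) := by
  have h : fittClass φ j (x - y) = fittClass φ j x - fittClass φ j y :=
    eq_sub_of_add_eq (by rw [← map_add, sub_add_cancel])
  rw [← sub_eq_zero, ← h, fittClass_eq_zero_iff, AddSubgroupClass.coe_sub]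

theorem eq_sum_fittClass (φ : Matrix m n R) {u : FittModule φ}
    {x : ∀ j : Fin (Fintype.card m + 1), minorIdeal φ j}
    (hx : ∀ j, u j = Submodule.Quotient.mk (x j)) : u = ∑ j : Fin (Fintype.card m + 1), fittClass φ (j : ℕ) (x j) := by
  refine DFinsupp.ext fun t => ?_
  rw [DirectSum.sum_apply, Finset.sum_eq_single t, fittClass_apply_self, hx]
  · exact fun j _ hj => fittClass_apply_of_ne φ (fun h => hj (Fin.ext h)) _
  · simp

theorem exists_rep (φ : Matrix m n R) (u : FittModule φ) :
    ∃ x : ∀ j : Fin (Fintype.card m + 1), minorIdeal φ j,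
      ∀ j, u j = Submodule.Quotient.mk (x j) := by
  choose x hx using fun j => Submodule.Quotient.mk_surjective _ (u j)
  exact ⟨x, fun j => (hx j).symm⟩

theorem FittModule.induction {φ : Matrix m n R} {M : AddSubmonoid (FittModule φ)}
    (h : ∀ (j : ℕ) (x : minorIdeal φ j), fittClass φ j x ∈ M) (u : FittModule φ) : u ∈ M := by
  obtain ⟨x, hx⟩ := exists_rep φ u
  rw [eq_sum_fittClass φ hx]
  exact sum_mem fun j _ => h _ _

/-- A semilinear map that carries `I_j(φ)` to `I_{j+e}(ψ)` induces a map of Fitting modules. -/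
theorem exists_fittMap (φ : Matrix m n R) (ψ : Matrix m' n' S) {τ : R →+* S} (T : R →ₛₗ[τ] S)
    (e : ℕ) (hT : ∀ j, ∀ x ∈ minorIdeal φ j, T x ∈ minorIdeal ψ (j + e)) :
    ∃ F : FittModule φ →ₛₗ[τ] FittModule ψ, ∀ (j : ℕ) (x : minorIdeal φ j),
      ∃ y : minorIdeal ψ (j + e), (y : S) = T x ∧ F (fittClass φ j x) = fittClass ψ (j + e) y := by
  let θ : ∀ j, minorIdeal φ j →ₛₗ[τ] minorIdeal ψ (j + e) := fun j =>
    (T.comp (minorIdeal φ j).subtype).codRestrict _ fun x => hT j x x.2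
  let F₁ : ∀ j, FittSummand φ j →ₛₗ[τ] FittModule ψ := fun j =>
    Submodule.liftQ (R₂ := S) (M₂ := FittModule ψ) ((minorIdeal φ (j + 1)).submoduleOf (minorIdeal φ j))
      ((fittClass ψ (j + e)).comp (θ j)) fun x hx => by
      rw [LinearMap.mem_ker, LinearMap.comp_apply, fittClass_eq_zero_iff]
      have := hT (j + 1) x hx
      rwa [add_right_comm] at this
  -- The map is assembled additively; compatibility with scalars through `τ` is then checked on
  -- classes, which generate additively.
  let F₀ : FittModule φ →+ FittModule ψ :=
    DirectSum.toAddMonoid fun j : Fin (Fintype.card m + 1) => (F₁ j).toAddMonoidHom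
  have hF₀ : ∀ (j : ℕ) (x : minorIdeal φ j), F₀ (fittClass φ j x) = fittClass ψ (j + e) (θ j x) := by
    intro j x
    by_cases hj : j < Fintype.card m + 1
    · rw [fittClass, dif_pos hj]
      exact DirectSum.toAddMonoid_of _ _ _
    · have hx : (x : R) ∈ (⊥ : Ideal R) := minorIdeal_eq_bot φ (j := j) (by omega) ▸ x.2
      have hx : x = 0 := Subtype.ext ((Submodule.mem_bot R).mp hx)
      simp [hx]
  refine ⟨{ F₀ with map_smul' := fun r u => ?_ }, fun j x => ⟨θ j x, rfl, hF₀ j x⟩⟩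
  let M : AddSubmonoid (FittModule φ) :=
    { carrier := {u | F₀ (r • u) = τ r • F₀ u}
      add_mem' := fun {a b} ha hb => by
        simp only [Set.mem_ofPred_eq] at *
        rw [smul_add, map_add, map_add, smul_add, ha, hb]
      zero_mem' := by simp }
  refine FittModule.induction (M := M) (fun j x => ?_) u
  change F₀ (r • fittClass φ j x) = τ r • F₀ (fittClass φ j x)
  rw [← map_smul, hF₀, hF₀, LinearMap.map_smulₛₗ, map_smul]

/-- The representative `x` is arbitrary, so it can be chosen homogeneous; this is how the maps are
shown to respect degrees. -/
theorem fittMap_apply {φ : Matrix m n R} {ψ : Matrix m' n' S} {F : FittModule φ →+ FittModule ψ} {T : R → S}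
  {e : ℕ} (hF : ∀ (j : ℕ) (x : minorIdeal φ j), ∃ y : minorIdeal ψ (j + e),
    (y : S) = T x ∧ F (fittClass φ j x) = fittClass ψ (j + e) y)
    {u : FittModule φ} {j : Fin (Fintype.card m + 1)} {x : minorIdeal φ j}
    (hx : u j = Submodule.Quotient.mk x) {t : Fin (Fintype.card m' + 1)} (ht : (j : ℕ) + e = t) :
    ∃ y : minorIdeal ψ t, (y : S) = T x ∧ F u t = Submodule.Quotient.mk y := by
  classical
  obtain ⟨x', hx'⟩ := exists_rep φ u
  choose y hy hFy using hF
  have hu := eq_sum_fittClass φ (x := Function.update x' j x) (u := u) fun k => by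
    by_cases hk : k = j
    · subst hk; simp [hx]
    · simp [hk, hx']
  obtain ⟨t, h⟩ := t
  obtain rfl : (j : ℕ) + e = t := ht
  refine ⟨y j x, hy _ _, ?_⟩
  rw [hu, map_sum, DirectSum.sum_apply, Finset.sum_eq_single j]
  · rw [hFy, Function.update_self]
    exact fittClass_apply_self ψ ⟨_, h⟩ _
  · intro k _ hk
    rw [hFy]
    exact fittClass_apply_of_ne ψ (fun h => hk (Fin.ext (by simpa using h))) _
  · simp

theorem fittMap_apply_of_lt {φ : Matrix m n R} {ψ : Matrix m' n' S} {F : FittModule φ →+ FittModule ψ} {T : R → S}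
  {e : ℕ} (hF : ∀ (j : ℕ) (x : minorIdeal φ j), ∃ y : minorIdeal ψ (j + e),
    (y : S) = T x ∧ F (fittClass φ j x) = fittClass ψ (j + e) y)
    (u : FittModule φ) {t : Fin (Fintype.card m' + 1)} (ht : (t : ℕ) < e) :
    F u t = 0 := by
  obtain ⟨x, hx⟩ := exists_rep φ u
  rw [eq_sum_fittClass φ hx, map_sum, DirectSum.sum_apply]
  refine Finset.sum_eq_zero fun j _ => ?_
  obtain ⟨y, -, hy⟩ := hF j (x j)
  rw [hy]
  exact fittClass_apply_of_ne ψ (by omega) y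

end Fitting

/-! ## The deletion-restriction sequence -/

section DeletionRestriction

variable {K : Type*} [Field K] {σ ι : Type*} [Fintype σ] [Fintype ι] [DecidableEq ι]
  {G : Matrix σ ι K} {i : ι}

theorem minorIdeal_codePresentation_insert (G : Matrix σ ι K) (i : ι) (a : ℕ) :
    minorIdeal (codePresentation G) a =
      productIdeal (columnForms G) (insert i (Finset.univ.erase i)) a := by
  rw [minorIdeal_codePresentation, Finset.insert_erase (Finset.mem_univ i)]

theorem columnForms_mul_mem_minorIdeal {a : ℕ} {x : MvPolynomial σ K}
    (hx : x ∈ minorIdeal (codePresentation (deletion G i)) a) :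
    columnForms G i * x ∈ minorIdeal (codePresentation G) (a + 1) := by
  rw [minorIdeal_deletion] at hx
  rw [minorIdeal_codePresentation_insert G i]
  exact mul_mem_productIdeal_insert _ (Finset.notMem_erase i _) hx

theorem minorIdeal_deletion_le (G : Matrix σ ι K) (i : ι) (a : ℕ) :
    minorIdeal (codePresentation (deletion G i)) a ≤ minorIdeal (codePresentation G) a := by
  rw [minorIdeal_deletion, minorIdeal_codePresentation]
  exact productIdeal_mono _ (Finset.subset_univ _) _

theorem exists_of_mem_minorIdeal_succ {a : ℕ} {x : MvPolynomial σ K}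
    (hx : x ∈ minorIdeal (codePresentation G) (a + 1)) :
    ∃ y ∈ minorIdeal (codePresentation (deletion G i)) (a + 1),
      ∃ z ∈ minorIdeal (codePresentation (deletion G i)) a, x = y + columnForms G i * z := by
  simp only [minorIdeal_deletion]
  rw [minorIdeal_codePresentation_insert G i] at hx
  exact exists_of_mem_productIdeal_insert _ hx

/-- The product equals `y + l * w` with `y` in the deletion ideal of index `a + 1` and `w` in that
of index `a`; the colon bound applies to `z - w`. -/
theorem mem_minorIdeal_deletion_of_mul_mem
    (hcolon : ∀ (a : ℕ) (z : MvPolynomial σ K),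
      columnForms G i * z ∈ minorIdeal (codePresentation (deletion G i)) (a + 1) →
        z ∈ minorIdeal (codePresentation (deletion G i)) a) {a : ℕ} {z : MvPolynomial σ K}
    (hz : columnForms G i * z ∈ minorIdeal (codePresentation G) (a + 1)) :
    z ∈ minorIdeal (codePresentation (deletion G i)) a := by
  obtain ⟨y, hy, w, hw, h⟩ := exists_of_mem_minorIdeal_succ (i := i) hz
  have := hcolon a (z - w) (by rwa [mul_sub, h, add_sub_cancel_right])
  simpa using add_mem this hw

variable [DecidableEq σ] {A : Matrix σ σ K} {p : σ}

theorem exists_restrictionHom_eq (hA : IsUnit A) {a : ℕ} {y : MvPolynomial {q : σ // q ≠ p} K}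
    (hy : y ∈ minorIdeal (codePresentation (restriction (A * G) p i)) a) :
    ∃ x ∈ minorIdeal (codePresentation (deletion G i)) a, restrictionHom A p x = y := by
  rw [minorIdeal_restriction] at hy
  rw [minorIdeal_deletion]
  exact (Ideal.mem_map_iff_of_surjective _ (restrictionHom_surjective hA)).mp hy

theorem restrictionHom_mem_minorIdeal (hAG : A.mulVec (fun s => G s i) = Pi.single p 1)
    {a : ℕ} {x : MvPolynomial σ K} (hx : x ∈ minorIdeal (codePresentation G) a) :
    restrictionHom A p x ∈ minorIdeal (codePresentation (restriction (A * G) p i)) a := by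
  rw [minorIdeal_restriction]
  rcases a with _ | a
  · simp [productIdeal_zero, Ideal.map_top]
  · obtain ⟨y, hy, z, -, rfl⟩ := exists_of_mem_minorIdeal_succ (i := i) hx
    rw [map_add, map_mul, columnForms, restrictionHom_linearForm_eq_zero hAG, zero_mul, add_zero]
    rw [minorIdeal_deletion] at hy
    exact Ideal.mem_map_of_mem _ hy

/-- Modulo `I (a + 1)`, the elements of `I a` that restrict to the next ideal are multiples of the
form `l` of the deleted column. -/
theorem exists_sub_mul_mem_minorIdeal (hA : IsUnit A)
    (hAG : A.mulVec (fun s => G s i) = Pi.single p 1) {a : ℕ} {x : MvPolynomial σ K}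
    (hx : restrictionHom A p x ∈
      minorIdeal (codePresentation (restriction (A * G) p i)) (a + 1)) :
    ∃ z, x - columnForms G i * z ∈ minorIdeal (codePresentation G) (a + 1) := by
  obtain ⟨y, hy, hxy⟩ := exists_restrictionHom_eq hA hx
  have hker : x - y ∈ RingHom.ker (restrictionHom A p) := by
    rw [RingHom.mem_ker, map_sub, hxy, sub_self]
  rw [ker_restrictionHom hA hAG] at hker
  obtain ⟨z, hz⟩ := Ideal.mem_span_singleton'.mp hker
  refine ⟨z, ?_⟩
  have : x - columnForms G i * z = y := by
    rw [columnForms, mul_comm, hz, sub_sub_cancel]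
  rw [this]
  exact minorIdeal_deletion_le G i _ hy

theorem exists_deletion_restriction_sequence
    (hcolon : ∀ (a : ℕ) (z : MvPolynomial σ K),
      columnForms G i * z ∈ minorIdeal (codePresentation (deletion G i)) (a + 1) →
        z ∈ minorIdeal (codePresentation (deletion G i)) a)
    (hA : IsUnit A) (hAG : A.mulVec (fun s => G s i) = Pi.single p 1) :
    ∃ (f : CodeFitt (deletion G i) →ₗ[MvPolynomial σ K] CodeFitt G)
      (g : CodeFitt G →ₛₗ[(restrictionHom A p : MvPolynomial σ K →+*
          MvPolynomial {q : σ // q ≠ p} K)] CodeFitt (restriction (A * G) p i)),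
      Function.Injective f ∧ Function.Exact f g ∧ Function.Surjective g ∧
      (∀ d : ℤ, ∀ u ∈ twist (fittGrading (deletion G i)) (-1) d, f u ∈ fittGrading G d) ∧
      (∀ d : ℤ, ∀ u ∈ fittGrading G d, g u ∈ fittGrading (restriction (A * G) p i) d) ∧
      (∀ (j : ℕ) (x : ↥(minorIdeal (codePresentation (deletion G i)) j)),
        ∃ y : ↥(minorIdeal (codePresentation G) (j + 1)),
          (y : MvPolynomial σ K) = columnForms G i * x ∧
            f (fittClass _ j x) = fittClass _ (j + 1) y) ∧
      (∀ (j : ℕ) (x : ↥(minorIdeal (codePresentation G) j)),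
        ∃ y : ↥(minorIdeal (codePresentation (restriction (A * G) p i)) j),
          (y : MvPolynomial {q : σ // q ≠ p} K) = restrictionHom A p x ∧
            g (fittClass _ j x) = fittClass _ j y) := by
  obtain ⟨f, hf⟩ := exists_fittMap (codePresentation (deletion G i)) (codePresentation G)
    (LinearMap.mulLeft (MvPolynomial σ K) (columnForms G i)) 1
    fun j x hx => columnForms_mul_mem_minorIdeal hx
  obtain ⟨g, hg⟩ := exists_fittMap (codePresentation G)
    (codePresentation (restriction (A * G) p i))
    (restrictionHom A p : MvPolynomial σ K →+*
          MvPolynomial {q : σ // q ≠ p} K).toSemilinearMap 0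
    fun j x hx => restrictionHom_mem_minorIdeal hAG hx
  have hcard : Fintype.card {j : ι // j ≠ i} + 1 = Fintype.card ι := by
    have := Fintype.card_pos_iff.mpr ⟨i⟩
    rw [Fintype.card_subtype_compl, Fintype.card_subtype_eq]
    omega
  refine ⟨f, g, ?_, ?_, ?_, ?_, ?_, hf, hg⟩
  · rw [injective_iff_map_eq_zero]
    intro u hu
    refine DFinsupp.ext fun j => ?_
    obtain ⟨x, hx⟩ := Submodule.Quotient.mk_surjective _ (u j)
    obtain ⟨y, hy, hfy⟩ := fittMap_apply (F := f.toAddMonoidHom) hf hx.symm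
      (t := ⟨j + 1, by omega⟩) rfl
    have h0 : f.toAddMonoidHom u = 0 := hu
    rw [h0, DirectSum.zero_apply, eq_comm, mk_eq_zero_iff, hy] at hfy
    rw [← hx, DFinsupp.zero_apply, mk_eq_zero_iff]
    exact mem_minorIdeal_deletion_of_mul_mem hcolon hfy
  · intro u
    constructor
    · intro hu
      obtain ⟨x, hx⟩ := exists_rep _ u
      have hmem : ∀ t : Fin (Fintype.card ι + 1), restrictionHom A p (x t) ∈
          minorIdeal (codePresentation (restriction (A * G) p i)) (t + 1) := by
        intro t
        by_cases ht : (t : ℕ) < Fintype.card {j : ι // j ≠ i} + 1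
        · obtain ⟨y, hy, hgy⟩ := fittMap_apply (F := g.toAddMonoidHom) hg (hx t)
            (t := ⟨t, ht⟩) rfl
          have h0 : g.toAddMonoidHom u = 0 := hu
          rw [h0, DirectSum.zero_apply, eq_comm, mk_eq_zero_iff, hy] at hgy
          exact hgy
        -- The top index has no counterpart in the restriction, which has one column fewer: its
        -- minor ideal there is zero.
        · have h := restrictionHom_mem_minorIdeal hAG (x t).2
          rw [minorIdeal_eq_bot _ (by omega), Submodule.mem_bot] at h
          rw [h]
          exact zero_mem _
      suffices u ∈ LinearMap.range f from this
      rw [eq_sum_fittClass _ hx]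
      refine Submodule.sum_mem _ fun t _ => ?_
      obtain ⟨z, hz⟩ := exists_sub_mul_mem_minorIdeal hA hAG (hmem t)
      obtain ⟨t, ht⟩ := t
      rcases t with _ | t
      -- The first map raises the index by one and so misses index `0`. There `x` already lies in `I
      -- 1`, since both `x - l * z` and `l * z` do.
      · have h0 : fittClass (codePresentation G) 0 (x ⟨0, ht⟩) = 0 := by
          rw [fittClass_eq_zero_iff]
          have h1 : columnForms G i * z ∈ minorIdeal (codePresentation G) (0 + 1) := by
            refine columnForms_mul_mem_minorIdeal ?_
            rw [minorIdeal_deletion, productIdeal_zero]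
            trivial
          simpa using add_mem hz h1
        rw [h0]
        exact zero_mem _
      · have hz' : z ∈ minorIdeal (codePresentation (deletion G i)) t := by
          refine mem_minorIdeal_deletion_of_mul_mem hcolon ?_
          have hle : minorIdeal (codePresentation G) (t + 1 + 1) ≤
              minorIdeal (codePresentation G) (t + 1) := by
            simp only [minorIdeal_codePresentation]
            exact productIdeal_succ_le _ _ _
          -- `l * z` is the difference of `x` and `x - l * z`, both in `I (t + 1)`.
          simpa using sub_mem (x ⟨t + 1, ht⟩).2 (hle hz)
        obtain ⟨y, hy, hfy⟩ := hf t ⟨z, hz'⟩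
        refine ⟨fittClass _ t ⟨z, hz'⟩, ?_⟩
        rw [hfy, eq_comm]
        refine (fittClass_eq_iff (codePresentation G)).mpr ?_
        rw [hy]
        exact hz
    · rintro ⟨v, rfl⟩
      refine FittModule.induction (M := AddMonoidHom.mker (g.toAddMonoidHom.comp f.toAddMonoidHom))
        (fun j x => ?_) v
      obtain ⟨y, hy, hfy⟩ := hf j x
      obtain ⟨y', hy', hgy⟩ := hg _ y
      change g (f (fittClass _ j x)) = 0
      rw [hfy, hgy, fittClass_eq_zero_iff, hy', hy]
      change restrictionHom A p (columnForms G i * x) ∈ _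
      rw [map_mul, columnForms, restrictionHom_linearForm_eq_zero hAG, zero_mul]
      exact zero_mem _
  · intro v
    refine FittModule.induction (M := AddMonoidHom.mrange g.toAddMonoidHom) (fun j y => ?_) v
    obtain ⟨x, hx, hxy⟩ := exists_restrictionHom_eq hA y.2
    obtain ⟨y', hy', hgy⟩ := hg j ⟨x, minorIdeal_deletion_le G i _ hx⟩
    refine ⟨_, hgy.trans ?_⟩
    congr 1
    exact Subtype.ext (hy'.trans hxy)
  · intro d u hu t
    obtain ⟨t, ht⟩ := t
    rcases t with _ | t
    · refine ⟨0, zero_mem _, ?_⟩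
      rw [Submodule.Quotient.mk_zero]
      exact fittMap_apply_of_lt (F := f.toAddMonoidHom) hf u Nat.one_pos
    · obtain ⟨x, hxd, hx⟩ := hu ⟨t, by omega⟩
      obtain ⟨y, hy, hfy⟩ := fittMap_apply (F := f.toAddMonoidHom) hf hx (t := ⟨t + 1, ht⟩) rfl
      refine ⟨y, ?_, hfy⟩
      rw [hy]
      exact linearForm_mul_mem_polyGrading _ hxd
  · intro d u hu t
    obtain ⟨x, hxd, hx⟩ := hu ⟨t, by omega⟩
    obtain ⟨y, hy, hgy⟩ := fittMap_apply (F := g.toAddMonoidHom) hg hx (t := t) rfl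
    refine ⟨y, ?_, hgy⟩
    rw [hy]
    exact restrictionHom_mem_polyGrading hxd

end DeletionRestriction

theorem theorem2p5 {K : Type*} [Field K] {n k : ℕ}
    (C : Submodule K (Fin n → K)) (hMDS : IsMDS C)
    (G : Matrix (Fin k) (Fin n) K) (hG : IsGeneratingMatrix C G)
    (i : Fin n)
    (p : Fin k) :
    -- there are row operations `A` that turn the `i`-th column of `G` into the basis vector `e_p`
    (∃ A : Matrix (Fin k) (Fin k) K, IsUnit A ∧ (fun q => (A * G) q i) = Pi.single p 1) ∧
    -- and for any such `A`, with the restriction obtained from `A * G`, there is an exact sequence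
    ∀ A : Matrix (Fin k) (Fin k) K, IsUnit A → (fun q => (A * G) q i) = Pi.single p 1 →
    -- the second map is semilinear along `R → R''`, that is, `R`-linear for the
    -- `R`-module structure that the Fitting module of the restriction gets from `R → R''`
    ∃ (f : CodeFitt (deletion G i) →ₗ[MvPolynomial (Fin k) K] CodeFitt G)
      (g : CodeFitt G →ₛₗ[(restrictionHom A p : MvPolynomial (Fin k) K →+*
          MvPolynomial {q : Fin k // q ≠ p} K)] CodeFitt (restriction (A * G) p i)),
      -- the ring map `R → R''` is the quotient by the form `ℓ` dual to the `i`-th column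
      (Function.Surjective (restrictionHom A p) ∧
        RingHom.ker (restrictionHom A p) = Ideal.span {columnForms G i}) ∧
      -- exactness
      Function.Injective f ∧ Function.Exact f g ∧ Function.Surjective g ∧
      -- both maps are homogeneous of degree zero
      (∀ d : ℤ, ∀ u ∈ twist (fittGrading (deletion G i)) (-1) d, f u ∈ fittGrading G d) ∧
      (∀ d : ℤ, ∀ u ∈ fittGrading G d, g u ∈ fittGrading (restriction (A * G) p i) d) ∧
      -- the first map is multiplication by `ℓ`, from `I'_j / I'_{j+1}` to `I_{j+1} / I_{j+2}`
      (∀ (j : ℕ) (x : ↥(minorIdeal (codePresentation (deletion G i)) j)),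
        ∃ y : ↥(minorIdeal (codePresentation G) (j + 1)),
          (y : MvPolynomial (Fin k) K) = columnForms G i * x ∧
            f (fittClass _ j x) = fittClass _ (j + 1) y) ∧
      -- the second map is induced by `R → R''`, from `I_j / I_{j+1}` to `I''_j / I''_{j+1}`
      (∀ (j : ℕ) (x : ↥(minorIdeal (codePresentation G) j)),
        ∃ y : ↥(minorIdeal (codePresentation (restriction (A * G) p i)) j),
          (y : MvPolynomial {q : Fin k // q ≠ p} K) = restrictionHom A p x ∧
            g (fittClass _ j x) = fittClass _ j y) := by

  have hspan : ∀ T : Finset (Fin n), Fintype.card (Fin k) ≤ T.card →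
      Submodule.span K ((fun j s => G s j) '' T) = ⊤ := fun T hT =>
    hMDS.span_columns_eq_top hG T (by simpa using hT)
  have hk : 0 < Fintype.card (Fin k) := Fintype.card_pos_iff.mpr ⟨p⟩
  have hkn : Fintype.card (Fin k) ≤ (Finset.univ : Finset (Fin n)).card := by simpa using hG.le
  have hcol : (fun s => G s i) ≠ 0 := fun h =>
    notMem_span_image_of_span_eq_top hspan hkn ∅ i (by simp) (by rwa [Finset.card_empty])
      (h ▸ zero_mem _)
  constructor
  · exact exists_isUnit_mulVec_eq hcol (by simp)
  · intro A hA hAG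
    obtain ⟨f, g, h⟩ := exists_deletion_restriction_sequence (G := G) (i := i) (fun a z hz => by
      rw [minorIdeal_deletion] at hz ⊢
      exact mem_productIdeal_of_linearForm_mul_mem hspan (Finset.notMem_erase i _) hk hkn hz) hA hAG
    exact ⟨f, g, ⟨restrictionHom_surjective hA, ker_restrictionHom hA hAG⟩, h⟩
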